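/- Let $\mathbb D^d=\{z\in\mathbb C^d: |z_i|<1,\ i=1,\dots,d\}$. For complex Hilbert spaces $\mathcal U,\mathcal V$, the Schur--Agler class $\mathcal{SA}_d(\mathcal U,\mathcal V)$ consists of the analytic functions $f(z)=\sum_{r\in\mathbb N_0^d} f_r z^r$ on $\mathbb D^d$, with values in the bounded operators $\mathcal L(\mathcal U,\mathcal V)$, such that for every $d$-tuple $T=(T_1,\dots,T_d)$ of commuting strict contractions ($\|T_i\|<1$) on a Hilbert space $\mathcal H$ the operator $f(T)=\sum_{r} f_r\otimes T^r:\mathcal U\otimes\mathcal H\to\mathcal V\otimes\mathcal H$ satisfies $\|f(T)\|\le 1$. Here $\otimes$ is the Hilbert space tensor product. Let $\mathcal U^{\otimes k}$ be the $k$-fold tensor power of $\mathcal U$, and let $\mathcal U^{\wedge k}\subseteq\mathcal U^{\otimes k}$ be the closed subspace generated by the elementary antisymmetric tensors $u_1\wedge\cdots\wedge u_k=\sum_{\sigma}\operatorname{sign}(\sigma)\,u_{\sigma(1)}\otimes\cdots\otimes u_{\sigma(k)}$, where $\sigma$ runs over the permutations of $1,\dots,k$. **Theorem.** Let $\mathcal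 U$ and $\mathcal V$ be Hilbert spaces and let $S_1,\dots,S_k\in\mathcal{SA}_d(\mathcal U,\mathcal V)$. Then the function $S_1\otimes\cdots\otimes S_k$, $z\mapsto S_1(z)\otimes\cdots\otimes S_k(z)$, belongs to $\mathcal{SA}_d(\mathcal U^{\otimes k},\mathcal V^{\otimes k})$, and its compression $S_1\wedge\cdots\wedge S_k$, $z\mapsto \pi_{\mathcal V^{\wedge k}}\big(S_1(z)\otimes\cdots\otimes S_k(z)\big)\big|_{\mathcal U^{\wedge k}}$, where $\pi_{\mathcal V^{\wedge k}}$ is the orthogonal projection of $\mathcal V^{\otimes k}$ onto $\mathcal V^{\wedge k}$, belongs to $\mathcal{SA}_d(\mathcal U^{\wedge k},\mathcal V^{\wedge k})$. **Corollary.** Let $S$ be an $n\times n$ matrix-valued Schur--Agler function, i.e. $S\in\mathcal{SA}_d(\mathbb C^n,\mathbb C^n)$ with $\mathbb C^n$ Euclidean. Then for every $k=1,\dots,n$ the $k$-th compound matrix-valued function of $S$, i.e. the $\binom nk\times\binom nk$ matrix whose entries are the minors $\det S(z)[I,J]$ for $k$-element subsets $I,J\subseteq\{1,\dots,n\}$,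 is also Schur--Agler. In particular, the scalar function $\det S(z)$ is Schur--Agler, i.e. belongs to $\mathcal{SA}_d(\mathbb C,\mathbb C)$. -/

import Mathlib

open scoped TensorProduct InnerProductSpace

universe u v w

noncomputable section

/-! ### Hilbert space tensor products -/

/-- The Hilbert space tensor product `E ⊗ F`: the completion of the algebraic tensor product for
the inner product with `⟪x ⊗ y, x' ⊗ y'⟫ = ⟪x, x'⟫ * ⟪y, y'⟫`. -/
abbrev HilbertTensor (E : Type u) (F : Type v)
    [NormedAddCommGroup E] [InnerProductSpace ℂ E]
    [NormedAddCommGroup F] [InnerProductSpace ℂ F] : Type (max u v) :=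
  UniformSpace.Completion (E ⊗[ℂ] F)

/-- The elementary tensor `x ⊗ y` in the Hilbert space tensor product. -/
def HilbertTensor.mk {E : Type u} {F : Type v}
    [NormedAddCommGroup E] [InnerProductSpace ℂ E]
    [NormedAddCommGroup F] [InnerProductSpace ℂ F] (x : E) (y : F) : HilbertTensor E F :=
  ((x ⊗ₜ[ℂ] y : E ⊗[ℂ] F) : UniformSpace.Completion (E ⊗[ℂ] F))

/-- The bounded operator `A ⊗ B` between Hilbert space tensor products, the continuous extension
of `x ⊗ y ↦ A x ⊗ B y`. -/
def HilbertTensor.map {E E' F F' : Type*}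
    [NormedAddCommGroup E] [InnerProductSpace ℂ E]
    [NormedAddCommGroup E'] [InnerProductSpace ℂ E']
    [NormedAddCommGroup F] [InnerProductSpace ℂ F]
    [NormedAddCommGroup F'] [InnerProductSpace ℂ F']
    (A : E →L[ℂ] E') (B : F →L[ℂ] F') : HilbertTensor E F →L[ℂ] HilbertTensor E' F' :=
  (TensorProduct.mapL A B).completion

/-! ### The Schur–Agler class -/

/-- The open unit polydisk in `ℂ^d`. -/
def polydisk (d : ℕ) : Set (Fin d → ℂ) := {z | ∀ i, ‖z i‖ < 1}

/-- The monomial `T^r = T_1^{r_1} ⋯ T_d^{r_d}` in a tuple of operators. -/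
def opMonomial {d : ℕ} {H : Type*} [NormedAddCommGroup H] [InnerProductSpace ℂ H]
    (T : Fin d → H →L[ℂ] H) (r : Fin d → ℕ) : H →L[ℂ] H :=
  (List.ofFn fun i => T i ^ r i).prod

/-- `c` is the family of power series coefficients of `f` on the polydisk:
`f z = ∑ r, z^r c_r` for every `z` in the polydisk. -/
def HasPolydiskExpansion {d : ℕ} {E : Type*} [NormedAddCommGroup E] [NormedSpace ℂ E]
    (c : (Fin d → ℕ) → E) (f : (Fin d → ℂ) → E) : Prop :=
  ∀ z ∈ polydisk d, HasSum (fun r : Fin d → ℕ => (∏ i, z i ^ r i) • c r) (f z)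

/-- The Schur–Agler class `SA_d(U, V)`: analytic `L(U, V)`-valued functions `f = ∑ r, c_r z^r` on
the polydisk such that `f(T) = ∑ r, c_r ⊗ T^r`, an operator from `U ⊗ H` to `V ⊗ H`, satisfies
`‖f(T)‖ ≤ 1` for every `d`-tuple `T` of commuting strict contractions on a Hilbert space `H`.
(The coefficients `c_r` are determined by `f`; the values of `f` off the polydisk play no role.) -/
def IsSchurAgler {d : ℕ} {U : Type u} {V : Type v}
    [NormedAddCommGroup U] [InnerProductSpace ℂ U]
    [NormedAddCommGroup V] [InnerProductSpace ℂ V]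
    (f : (Fin d → ℂ) → U →L[ℂ] V) : Prop :=
  AnalyticOnNhd ℂ f (polydisk d) ∧
  ∃ c : (Fin d → ℕ) → U →L[ℂ] V, HasPolydiskExpansion c f ∧
    ∀ (H : Type w) [NormedAddCommGroup H] [InnerProductSpace ℂ H] [CompleteSpace H]
      (T : Fin d → H →L[ℂ] H), (∀ i j, Commute (T i) (T j)) → (∀ i, ‖T i‖ < 1) →
      ∃ fT : HilbertTensor U H →L[ℂ] HilbertTensor V H,
        HasSum (fun r : Fin d → ℕ => HilbertTensor.map (c r) (opMonomial T r)) fT ∧ ‖fT‖ ≤ 1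

/-! ### Tensor powers -/

/-- A complex Hilbert space, bundled, so that the tensor powers can be defined by recursion. -/
structure BundledHilbert : Type (u + 1) where
  carrier : Type u
  [normed : NormedAddCommGroup carrier]
  [inner : InnerProductSpace ℂ carrier]
  [complete : CompleteSpace carrier]

/-- The tensor powers of `U`, bundled: `U^{⊗0}` is the one-dimensional space `ℂ` (in the universe
of `U`), and `U^{⊗(k+1)} = U^{⊗k} ⊗ U`. -/
def bundledTensorPower (U : Type u) [NormedAddCommGroup U] [InnerProductSpace ℂ U] :
    ℕ → BundledHilbert.{u}
  | 0 => ⟨EuclideanSpace ℂ PUnit.{u + 1}⟩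
  | k + 1 =>
    letI := (bundledTensorPower U k).normed
    letI := (bundledTensorPower U k).inner
    ⟨HilbertTensor (bundledTensorPower U k).carrier U⟩

/-- The `k`-fold Hilbert space tensor power `U^{⊗k}`. -/
def TensorPow (k : ℕ) (U : Type u) [NormedAddCommGroup U] [InnerProductSpace ℂ U] : Type u :=
  (bundledTensorPower U k).carrier

instance (k : ℕ) (U : Type u) [NormedAddCommGroup U] [InnerProductSpace ℂ U] :
    NormedAddCommGroup (TensorPow k U) := (bundledTensorPower U k).normed

instance (k : ℕ) (U : Type u) [NormedAddCommGroup U] [InnerProductSpace ℂ U] :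
    InnerProductSpace ℂ (TensorPow k U) := (bundledTensorPower U k).inner

instance (k : ℕ) (U : Type u) [NormedAddCommGroup U] [InnerProductSpace ℂ U] :
    CompleteSpace (TensorPow k U) := (bundledTensorPower U k).complete

/-- The elementary tensor `v_1 ⊗ ⋯ ⊗ v_k` in `U^{⊗k}`. -/
def TensorPow.tprod {U : Type u} [NormedAddCommGroup U] [InnerProductSpace ℂ U] :
    (k : ℕ) → (Fin k → U) → TensorPow k U
  | 0, _ => (EuclideanSpace.single PUnit.unit 1 : EuclideanSpace ℂ PUnit.{u + 1})
  | k + 1, x =>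
    (HilbertTensor.mk (TensorPow.tprod k fun i => x i.castSucc) (x (Fin.last k)) :
      HilbertTensor (TensorPow k U) U)

/-- The bounded operator `A_1 ⊗ ⋯ ⊗ A_k : U^{⊗k} → V^{⊗k}`. For `k = 0` it is the identity of `ℂ`
(between the copies of `ℂ` in the two universes). -/
def TensorPow.map {U : Type u} {V : Type v}
    [NormedAddCommGroup U] [InnerProductSpace ℂ U]
    [NormedAddCommGroup V] [InnerProductSpace ℂ V] :
    (k : ℕ) → (Fin k → U →L[ℂ] V) → (TensorPow k U →L[ℂ] TensorPow k V)
  | 0, _ =>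
    ((LinearIsometryEquiv.piLpCongrLeft 2 ℂ ℂ
      (Equiv.punitEquivPUnit : PUnit.{u + 1} ≃ PUnit.{v + 1}) :
        EuclideanSpace ℂ PUnit.{u + 1} ≃ₗᵢ[ℂ] EuclideanSpace ℂ PUnit.{v + 1}) :
      EuclideanSpace ℂ PUnit.{u + 1} →L[ℂ] EuclideanSpace ℂ PUnit.{v + 1})
  | k + 1, A =>
    (HilbertTensor.map (TensorPow.map k fun i => A i.castSucc) (A (Fin.last k)) :
      HilbertTensor (TensorPow k U) U →L[ℂ] HilbertTensor (TensorPow k V) V)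

/-! ### Antisymmetric tensor powers -/

/-- The elementary antisymmetric tensor
`v_1 ∧ ⋯ ∧ v_k = ∑ σ, sign(σ) v_{σ(1)} ⊗ ⋯ ⊗ v_{σ(k)}` in `U^{⊗k}`. -/
def TensorPow.wedge {U : Type u} [NormedAddCommGroup U] [InnerProductSpace ℂ U]
    (k : ℕ) (x : Fin k → U) : TensorPow k U :=
  ∑ σ : Equiv.Perm (Fin k), ((Equiv.Perm.sign σ : ℤ) : ℂ) • TensorPow.tprod k fun i => x (σ i)

/-- The antisymmetric tensor power `U^{∧k}`: the closed subspace of `U^{⊗k}` generated by the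
elementary antisymmetric tensors. -/
abbrev WedgePow (k : ℕ) (U : Type u) [NormedAddCommGroup U] [InnerProductSpace ℂ U] :
    Submodule ℂ (TensorPow k U) :=
  (Submodule.span ℂ (Set.range (TensorPow.wedge (U := U) k))).topologicalClosure

/-- The function `S_1 ⊗ ⋯ ⊗ S_k`, `z ↦ S_1(z) ⊗ ⋯ ⊗ S_k(z)`. -/
def tensorFun {d k : ℕ} {U : Type u} {V : Type v}
    [NormedAddCommGroup U] [InnerProductSpace ℂ U]
    [NormedAddCommGroup V] [InnerProductSpace ℂ V]
    (S : Fin k → (Fin d → ℂ) → U →L[ℂ] V) (z : Fin d → ℂ) :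
    TensorPow k U →L[ℂ] TensorPow k V :=
  TensorPow.map k fun j => S j z

/-- The function `S_1 ∧ ⋯ ∧ S_k`, the compression of `S_1 ⊗ ⋯ ⊗ S_k` to the antisymmetric
subspaces: restriction to `U^{∧k}` followed by the orthogonal projection onto `V^{∧k}`. -/
def wedgeFun {d k : ℕ} {U : Type u} {V : Type v}
    [NormedAddCommGroup U] [InnerProductSpace ℂ U]
    [NormedAddCommGroup V] [InnerProductSpace ℂ V]
    (S : Fin k → (Fin d → ℂ) → U →L[ℂ] V) (z : Fin d → ℂ) :
    WedgePow k U →L[ℂ] WedgePow k V :=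
  (WedgePow k V).orthogonalProjectionOnto ∘L tensorFun S z ∘L (WedgePow k U).subtypeL

/-! ### Compound matrices -/

/-- The `k`-th compound matrix of `M`: rows and columns are indexed by the `k`-element subsets
`I`, `J` of the index set, listed increasingly, and the entries are the minors `det M[I, J]`. -/
def compoundMatrix {n : ℕ} (k : ℕ) (M : Matrix (Fin n) (Fin n) ℂ) :
    Matrix {s : Finset (Fin n) // s.card = k} {s : Finset (Fin n) // s.card = k} ℂ :=
  Matrix.of fun I J => (M.submatrix (I.1.orderEmbOfFin I.2) (J.1.orderEmbOfFin J.2)).det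

/-- A matrix-valued function is Schur–Agler if the corresponding function with values in the
operators on the Euclidean space `ℂ^ι` is. -/
def IsMatrixSchurAgler {d : ℕ} {ι : Type*} [Fintype ι] [DecidableEq ι]
    (F : (Fin d → ℂ) → Matrix ι ι ℂ) : Prop :=
  IsSchurAgler.{_, _, w} fun z =>
    (Matrix.toEuclideanCLM (n := ι) (𝕜 := ℂ) (F z) : EuclideanSpace ℂ ι →L[ℂ] EuclideanSpace ℂ ι)

/-- A scalar function `g` is Schur–Agler if it is so as a function with values in `L(ℂ, ℂ)`, the
scalar `g z` acting by multiplication. -/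
def IsScalarSchurAgler {d : ℕ} (g : (Fin d → ℂ) → ℂ) : Prop :=
  IsSchurAgler.{_, _, w} fun z => g z • ContinuousLinearMap.id ℂ ℂ

end

/-!
Up to a permutation of the tensor factors, `(f ⊗ g)(T)` is the product of `f(T) ⊗ 1` and
`1 ⊗ g(T)`, hence a contraction whenever `f(T)` and `g(T)` are. The coefficients of `f ⊗ g` form a
Cauchy product and `T^(r + s) = T^r T^s` for commuting operators, so the two sides agree once the
double series may be rearranged. It converges absolutely: if `‖T i‖ < R i < 1`, the numbers
`‖c_r‖ R^r` are bounded, so the terms are dominated by a geometric series.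

Compressions do not increase norms, and the remaining functions are compressions of tensor powers:
the normalized wedge products of standard basis vectors are orthonormal, and the matrix elements
of `M ⊗ ⋯ ⊗ M` between them are the minors of `M`.
-/

section Summation

variable {𝕜 E F G : Type*} [NontriviallyNormedField 𝕜]
  [NormedAddCommGroup E] [NormedSpace 𝕜 E] [NormedAddCommGroup F] [NormedSpace 𝕜 F]
  [NormedAddCommGroup G] [NormedSpace 𝕜 G] [CompleteSpace G]

theorem hasSum_bilinear_prod {ι κ : Type*} (L : E →L[𝕜] F →L[𝕜] G) {f : ι → E} {g : κ → F}
    {a : E} {b : F} (hf : HasSum f a) (hg : HasSum g b)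
    (hf_norm : Summable fun i => ‖f i‖) (hg_norm : Summable fun j => ‖g j‖) :
    HasSum (fun p : ι × κ => L (f p.1) (g p.2)) (L a b) := by
  have summable_norm_mul : Summable fun p : ι × κ => ‖L‖ * (‖f p.1‖ * ‖g p.2‖) :=
    (hf_norm.mul_of_nonneg hg_norm (fun _ => norm_nonneg _) fun _ => norm_nonneg _).mul_left _
  have summable_prod : Summable fun p : ι × κ => L (f p.1) (g p.2) :=
    summable_norm_mul.of_norm_bounded fun p => by
      rw [← mul_assoc]
      exact L.le_opNorm₂ _ _
  have iterated : HasSum (fun i => L (f i) b) (∑' p : ι × κ, L (f p.1) (g p.2)) :=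
    summable_prod.hasSum.prod_fiberwise fun i => (L (f i)).hasSum hg
  have sum_eq : L a b = ∑' p : ι × κ, L (f p.1) (g p.2) :=
    ((L.flip b).hasSum hf).unique iterated
  exact sum_eq ▸ summable_prod.hasSum

theorem hasSum_bilinear_antidiagonal {ι : Type*} [AddMonoid ι] [Finset.HasAntidiagonal ι]
    (L : E →L[𝕜] F →L[𝕜] G) {f : ι → E} {g : ι → F}
    {a : E} {b : F} (hf : HasSum f a) (hg : HasSum g b)
    (hf_norm : Summable fun i => ‖f i‖) (hg_norm : Summable fun j => ‖g j‖) :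
    HasSum (fun n => ∑ p ∈ Finset.HasAntidiagonal.antidiagonal n, L (f p.1) (g p.2)) (L a b) :=
  (Finset.HasAntidiagonal.sigmaAntidiagonalEquivProd.hasSum_iff.2
    (hasSum_bilinear_prod L hf hg hf_norm hg_norm)).sigma fun n =>
      (Finset.HasAntidiagonal.antidiagonal n).hasSum fun p : ι × ι => L (f p.1) (g p.2)

theorem hasSum_comp_antidiagonal {ι : Type*} [AddMonoid ι] [Finset.HasAntidiagonal ι]
    {f : ι → F →L[𝕜] G} {g : ι → E →L[𝕜] F} {A : F →L[𝕜] G} {B : E →L[𝕜] F}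
    (hf : HasSum f A) (hg : HasSum g B)
    (hf_norm : Summable fun i => ‖f i‖) (hg_norm : Summable fun j => ‖g j‖) :
    HasSum (fun n => ∑ p ∈ Finset.HasAntidiagonal.antidiagonal n, f p.1 ∘L g p.2) (A ∘L B) :=
  hasSum_bilinear_antidiagonal (ContinuousLinearMap.compL 𝕜 E F G) hf hg hf_norm hg_norm

end Summation

theorem summable_prod_apply_of_nonneg {α : Type*} : ∀ {d : ℕ} {f : Fin d → α → ℝ},
    (∀ i a, 0 ≤ f i a) → (∀ i, Summable (f i)) →
      Summable fun r : Fin d → α => ∏ i, f i (r i)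
  | 0, _, _, _ => Summable.of_finite
  | d + 1, f, f_nonneg, hf => by
    have summable_head_mul_tail := (hf 0).mul_of_nonneg
      (summable_prod_apply_of_nonneg (fun i => f_nonneg i.succ) fun i => hf i.succ)
      (f_nonneg 0) fun r => Finset.prod_nonneg fun i _ => f_nonneg i.succ (r i)
    rw [← (Fin.consEquiv fun _ : Fin (d + 1) => α).summable_iff]
    refine summable_head_mul_tail.congr fun p => ?_
    simp [Fin.consEquiv, Fin.prod_univ_succ]

namespace HasPolydiskExpansion

variable {d : ℕ} {E : Type*} [NormedAddCommGroup E] [NormedSpace ℂ E]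
  {c : (Fin d → ℕ) → E} {f : (Fin d → ℂ) → E}

theorem exists_norm_mul_prod_le (h : HasPolydiskExpansion c f) {ρ : Fin d → ℝ}
    (ρ_nonneg : ∀ i, 0 ≤ ρ i) (ρ_lt_one : ∀ i, ρ i < 1) :
    ∃ C, ∀ r, ‖c r‖ * ∏ i, ρ i ^ r i ≤ C := by
  have mem_polydisk : (fun i => (ρ i : ℂ)) ∈ polydisk d := fun i => by
    rw [Complex.norm_of_nonneg (ρ_nonneg i)]
    exact ρ_lt_one i
  obtain ⟨C, hC⟩ :=
    (h _ mem_polydisk).summable.tendsto_cofinite_zero.norm.bddAbove_range_of_cofinite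
  refine ⟨C, fun r => le_of_eq_of_le ?_ (hC ⟨r, rfl⟩)⟩
  simp only [norm_smul, norm_prod, norm_pow, Complex.norm_of_nonneg (ρ_nonneg _)]
  exact mul_comm _ _

theorem summable_norm_mul_prod (h : HasPolydiskExpansion c f) {ρ : Fin d → ℝ}
    (ρ_nonneg : ∀ i, 0 ≤ ρ i) (ρ_lt_one : ∀ i, ρ i < 1) :
    Summable fun r => ‖c r‖ * ∏ i, ρ i ^ r i := by
  choose R ρ_lt_R R_lt_one using fun i => exists_between (ρ_lt_one i)
  have R_pos : ∀ i, 0 < R i := fun i => (ρ_nonneg i).trans_lt (ρ_lt_R i)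
  obtain ⟨C, hC⟩ := h.exists_norm_mul_prod_le (fun i => (R_pos i).le) R_lt_one
  have ratio_nonneg : ∀ i, 0 ≤ ρ i / R i := fun i => div_nonneg (ρ_nonneg i) (R_pos i).le
  have summable_ratio : Summable fun r : Fin d → ℕ => ∏ i, (ρ i / R i) ^ r i :=
    summable_prod_apply_of_nonneg (fun i n => pow_nonneg (ratio_nonneg i) n) fun i =>
      summable_geometric_of_lt_one (ratio_nonneg i) ((div_lt_one (R_pos i)).2 (ρ_lt_R i))
  refine (summable_ratio.mul_left C).of_nonneg_of_le
    (fun r => mul_nonneg (norm_nonneg _) (Finset.prod_nonneg fun i _ =>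
      pow_nonneg (ρ_nonneg i) _)) fun r => ?_
  calc ‖c r‖ * ∏ i, ρ i ^ r i
      = (‖c r‖ * ∏ i, R i ^ r i) * ∏ i, (ρ i / R i) ^ r i := by
        rw [mul_assoc, ← Finset.prod_mul_distrib]
        simp only [← mul_pow, mul_div_cancel₀ _ (R_pos _).ne']
    _ ≤ C * ∏ i, (ρ i / R i) ^ r i :=
        mul_le_mul_of_nonneg_right (hC r)
          (Finset.prod_nonneg fun i _ => pow_nonneg (ratio_nonneg i) _)

theorem summable_norm_smul (h : HasPolydiskExpansion c f) {z : Fin d → ℂ}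
    (hz : z ∈ polydisk d) : Summable fun r => ‖(∏ i, z i ^ r i) • c r‖ := by
  simpa only [norm_smul, norm_prod, norm_pow, mul_comm] using
    h.summable_norm_mul_prod (fun i => norm_nonneg (z i)) hz

end HasPolydiskExpansion

section OpMonomial

variable {d : ℕ} {H : Type*} [NormedAddCommGroup H] [InnerProductSpace ℂ H]

theorem opMonomial_succ (T : Fin (d + 1) → H →L[ℂ] H) (r : Fin (d + 1) → ℕ) :
    opMonomial T r = T 0 ^ r 0 * opMonomial (Fin.tail T) (Fin.tail r) := by
  simp [opMonomial, List.ofFn_succ, Fin.tail]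

theorem opMonomial_zero (T : Fin d → H →L[ℂ] H) : opMonomial T 0 = 1 := by
  simp [opMonomial]

theorem commute_opMonomial {A : H →L[ℂ] H} {T : Fin d → H →L[ℂ] H}
    (hA : ∀ i, Commute A (T i)) (r : Fin d → ℕ) : Commute A (opMonomial T r) := by
  refine Commute.list_prod_right _ _ fun B hB => ?_
  obtain ⟨i, rfl⟩ := List.mem_ofFn.1 hB
  exact (hA i).pow_right _

theorem opMonomial_add : ∀ {d : ℕ} {T : Fin d → H →L[ℂ] H}, (∀ i j, Commute (T i) (T j)) →
    ∀ r s : Fin d → ℕ, opMonomial T (r + s) = opMonomial T r * opMonomial T s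
  | 0, _, _, _, _ => by simp [opMonomial]
  | d + 1, T, hT, r, s => by
    have tail_add : opMonomial (Fin.tail T) (Fin.tail (r + s)) =
        opMonomial (Fin.tail T) (Fin.tail r) * opMonomial (Fin.tail T) (Fin.tail s) :=
      opMonomial_add (fun i j => hT i.succ j.succ) _ _
    have head_commute : Commute (T 0 ^ s 0) (opMonomial (Fin.tail T) (Fin.tail r)) :=
      commute_opMonomial (fun i => (hT 0 i.succ).pow_left _) _
    simp only [opMonomial_succ, tail_add, Pi.add_apply, pow_add,
      head_commute.mul_mul_mul_comm]

theorem norm_opMonomial_le : ∀ {d : ℕ} (T : Fin d → H →L[ℂ] H) (r : Fin d → ℕ),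
    ‖opMonomial T r‖ ≤ ∏ i, ‖T i‖ ^ r i
  | 0, _, _ => by
    rw [Fin.prod_univ_zero]
    exact ContinuousLinearMap.norm_id_le
  | d + 1, T, r => by
    rw [opMonomial_succ, Fin.prod_univ_succ]
    refine norm_mul_le_of_le ?_ (norm_opMonomial_le _ _)
    rcases (r 0).eq_zero_or_pos with h | h
    · rw [h, pow_zero, pow_zero]
      exact ContinuousLinearMap.norm_id_le
    · exact norm_pow_le' _ h

end OpMonomial

section IsometryEquivOfInnerEq

theorem denseRange_linearCombination {R ι M : Type*} [Semiring R] [AddCommMonoid M] [Module R M]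
    [TopologicalSpace M] {a : ι → M} (ha : Dense (Submodule.span R (Set.range a) : Set M)) :
    DenseRange (Finsupp.linearCombination R a) := by
  rwa [← Finsupp.range_linearCombination] at ha

variable {𝕜 ι E F : Type*} [RCLike 𝕜] [NormedAddCommGroup E] [InnerProductSpace 𝕜 E]
  [NormedAddCommGroup F] [InnerProductSpace 𝕜 F] {a : ι → E} {b : ι → F}

theorem norm_linearCombination_eq_of_inner_eq (h : ∀ i j, ⟪b i, b j⟫_𝕜 = ⟪a i, a j⟫_𝕜)
    (x : ι →₀ 𝕜) :
    ‖Finsupp.linearCombination 𝕜 b x‖ = ‖Finsupp.linearCombination 𝕜 a x‖ := by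
  simp only [norm_eq_sqrt_re_inner (𝕜 := 𝕜), Finsupp.linearCombination_apply, Finsupp.sum,
    sum_inner, inner_sum, inner_smul_left, inner_smul_right, h]

variable [CompleteSpace E] [CompleteSpace F]

/-- The unitary operator carrying a family with dense span to another such family with the same
Gram matrix. -/
noncomputable def isometryEquivOfInnerEq
    (ha : Dense (Submodule.span 𝕜 (Set.range a) : Set E))
    (hb : Dense (Submodule.span 𝕜 (Set.range b) : Set F))
    (h : ∀ i j, ⟪b i, b j⟫_𝕜 = ⟪a i, a j⟫_𝕜) : E ≃ₗᵢ[𝕜] F :=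
  (LinearEquiv.refl 𝕜 (ι →₀ 𝕜)).extendOfIsometry (Finsupp.linearCombination 𝕜 a)
    (Finsupp.linearCombination 𝕜 b) (denseRange_linearCombination ha)
    (denseRange_linearCombination hb) (norm_linearCombination_eq_of_inner_eq h)

theorem isometryEquivOfInnerEq_apply (ha : Dense (Submodule.span 𝕜 (Set.range a) : Set E))
    (hb : Dense (Submodule.span 𝕜 (Set.range b) : Set F))
    (h : ∀ i j, ⟪b i, b j⟫_𝕜 = ⟪a i, a j⟫_𝕜) (i : ι) :
    isometryEquivOfInnerEq ha hb h (a i) = b i := by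
  simpa [isometryEquivOfInnerEq] using (LinearEquiv.refl 𝕜 (ι →₀ 𝕜)).extendOfIsometry_eq
    (Finsupp.linearCombination 𝕜 a) (Finsupp.linearCombination 𝕜 b)
    (denseRange_linearCombination ha) (denseRange_linearCombination hb)
    (norm_linearCombination_eq_of_inner_eq h) (Finsupp.single i 1)

end IsometryEquivOfInnerEq

namespace HilbertTensor

variable {E E' E'' F F' F'' G X : Type*}
  [NormedAddCommGroup E] [InnerProductSpace ℂ E]
  [NormedAddCommGroup E'] [InnerProductSpace ℂ E']
  [NormedAddCommGroup E''] [InnerProductSpace ℂ E'']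
  [NormedAddCommGroup F] [InnerProductSpace ℂ F]
  [NormedAddCommGroup F'] [InnerProductSpace ℂ F']
  [NormedAddCommGroup F''] [InnerProductSpace ℂ F'']
  [NormedAddCommGroup G] [InnerProductSpace ℂ G]
  [NormedAddCommGroup X] [NormedSpace ℂ X]

theorem inner_mk (x x' : E) (y y' : F) :
    ⟪mk x y, mk x' y'⟫_ℂ = ⟪x, x'⟫_ℂ * ⟪y, y'⟫_ℂ := by
  rw [mk, mk, UniformSpace.Completion.inner_coe, TensorProduct.inner_tmul]

theorem map_mk (A : E →L[ℂ] E') (B : F →L[ℂ] F') (x : E) (y : F) :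
    map A B (mk x y) = mk (A x) (B y) := by
  simp [mk, map, ContinuousLinearMap.completion_apply_coe]

variable (E F) in
/-- The elementary tensor `x ⊗ y` as a continuous bilinear function of `(x, y)`. -/
noncomputable def mkL : E →L[ℂ] F →L[ℂ] HilbertTensor E F :=
  (UniformSpace.Completion.toComplL.postcomp F).comp (TensorProduct.mkL ℂ E F)

theorem mkL_apply (x : E) (y : F) : mkL E F x y = mk x y := rfl

theorem dense_span_range_mk :
    Dense (Submodule.span ℂ (Set.range fun p : E × F => mk p.1 p.2) :
      Set (HilbertTensor E F)) := by
  have span_eq_range : Submodule.span ℂ (Set.range fun p : E × F => mk p.1 p.2) =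
      LinearMap.range
        (UniformSpace.Completion.toComplL (𝕜 := ℂ) (E := E ⊗[ℂ] F)).toLinearMap := by
    rw [LinearMap.range_eq_map, ← TensorProduct.span_tmul_eq_top, Submodule.map_span]
    congr 1
    ext t
    simp [mk, eq_comm]
  rw [span_eq_range]
  exact UniformSpace.Completion.denseRange_coe

theorem dense_span_range_mk_of_dense {ι κ : Type*} {a : ι → E} {b : κ → F}
    (ha : Dense (Submodule.span ℂ (Set.range a) : Set E))
    (hb : Dense (Submodule.span ℂ (Set.range b) : Set F)) :
    Dense (Submodule.span ℂ (Set.range fun p : ι × κ => mk (a p.1) (b p.2)) :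
      Set (HilbertTensor E F)) := by
  have mk_mem_span : ∀ x ∈ Submodule.span ℂ (Set.range a), ∀ y ∈ Submodule.span ℂ (Set.range b),
      mk x y ∈ Submodule.span ℂ (Set.range fun p : ι × κ => mk (a p.1) (b p.2)) := by
    intro x hx y hy
    have mem_map₂ := Submodule.apply_mem_map₂ (mkL E F).toLinearMap₁₂ hx hy
    rwa [Submodule.map₂_span_span, Set.image2_range] at mem_map₂
  have mk_mem_closure : Set.range (fun p : E × F => mk p.1 p.2) ⊆
      (Submodule.span ℂ (Set.range fun p : ι × κ => mk (a p.1) (b p.2))).topologicalClosure := by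
    rintro _ ⟨p, rfl⟩
    exact map_mem_closure₂ (mkL E F).continuous₂ (ha p.1) (hb p.2) mk_mem_span
  exact dense_closure.1 (dense_span_range_mk.mono (Submodule.span_le.2 mk_mem_closure))

theorem dense_span_range_mk_mk :
    Dense (Submodule.span ℂ (Set.range fun p : (E × F) × G => mk (mk p.1.1 p.1.2) p.2) :
      Set (HilbertTensor (HilbertTensor E F) G)) :=
  dense_span_range_mk_of_dense (a := fun p : E × F => mk p.1 p.2) (b := (id : G → G))
    dense_span_range_mk (by simp)

theorem dense_span_range_mk_mk_right :
    Dense (Submodule.span ℂ (Set.range fun p : (E × F) × G => mk p.1.1 (mk p.1.2 p.2)) :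
      Set (HilbertTensor E (HilbertTensor F G))) := by
  have dense := dense_span_range_mk_of_dense (a := (id : E → E)) (b := fun p : F × G => mk p.1 p.2)
    (by simp) dense_span_range_mk
  rwa [← (Equiv.prodAssoc E F G).surjective.range_comp] at dense

theorem dense_span_range_mk_mk_swap :
    Dense (Submodule.span ℂ (Set.range fun p : (E × F) × G => mk (mk p.1.1 p.2) p.1.2) :
      Set (HilbertTensor (HilbertTensor E G) F)) := by
  have surjective_swap :
      Function.Surjective fun p : (E × F) × G => ((p.1.1, p.2), p.1.2) :=
    fun q => ⟨((q.1.1, q.2), q.1.2), rfl⟩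
  have dense := dense_span_range_mk_mk (E := E) (F := G) (G := F)
  rwa [← surjective_swap.range_comp] at dense

theorem ext_mk {A B : HilbertTensor E F →L[ℂ] X} (h : ∀ x y, A (mk x y) = B (mk x y)) :
    A = B := by
  refine ContinuousLinearMap.ext_on dense_span_range_mk ?_
  rintro _ ⟨p, rfl⟩
  exact h _ _

theorem ext_mk_mk {A B : HilbertTensor (HilbertTensor E F) G →L[ℂ] X}
    (h : ∀ x y z, A (mk (mk x y) z) = B (mk (mk x y) z)) : A = B := by
  refine ContinuousLinearMap.ext_on dense_span_range_mk_mk ?_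
  rintro _ ⟨p, rfl⟩
  exact h _ _ _

theorem norm_map_le (A : E →L[ℂ] E') (B : F →L[ℂ] F') : ‖map A B‖ ≤ ‖A‖ * ‖B‖ := by
  refine ContinuousLinearMap.opNorm_le_bound _ (by positivity) fun z => ?_
  induction z using UniformSpace.Completion.induction_on with
  | hp => exact isClosed_le (map A B).continuous.norm (continuous_const.mul continuous_norm)
  | ih t =>
    rw [map, ContinuousLinearMap.completion_apply_coe, UniformSpace.Completion.norm_coe,
      UniformSpace.Completion.norm_coe]
    exact (TensorProduct.mapL A B).le_of_opNorm_le (TensorProduct.norm_mapL_le A B) t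

theorem map_comp_map (A' : E' →L[ℂ] E'') (B' : F' →L[ℂ] F'') (A : E →L[ℂ] E')
    (B : F →L[ℂ] F') : map A' B' ∘L map A B = map (A' ∘L A) (B' ∘L B) :=
  ext_mk fun x y => by simp only [ContinuousLinearMap.comp_apply, map_mk]

theorem map_add_left (A A' : E →L[ℂ] E') (B : F →L[ℂ] F') :
    map (A + A') B = map A B + map A' B :=
  ext_mk fun x y => by
    rw [add_apply, map_mk, map_mk, map_mk, ← mkL_apply, add_apply, map_add, add_apply]; rfl

theorem map_add_right (A : E →L[ℂ] E') (B B' : F →L[ℂ] F') :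
    map A (B + B') = map A B + map A B' :=
  ext_mk fun x y => by
    rw [add_apply, map_mk, map_mk, map_mk, ← mkL_apply, add_apply, map_add]; rfl

theorem map_smul_left (r : ℂ) (A : E →L[ℂ] E') (B : F →L[ℂ] F') :
    map (r • A) B = r • map A B :=
  ext_mk fun x y => by
    rw [smul_apply, map_mk, map_mk, ← mkL_apply, smul_apply, map_smul, smul_apply]; rfl

theorem map_smul_right (r : ℂ) (A : E →L[ℂ] E') (B : F →L[ℂ] F') :
    map A (r • B) = r • map A B :=
  ext_mk fun x y => by
    rw [smul_apply, map_mk, map_mk, ← mkL_apply, smul_apply, map_smul]; rfl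

variable (E E' F F') in
/-- The tensor product `A ⊗ B` of operators as a bilinear function of `(A, B)`. -/
noncomputable def mapₗ : (E →L[ℂ] E') →ₗ[ℂ] (F →L[ℂ] F') →ₗ[ℂ]
    (HilbertTensor E F →L[ℂ] HilbertTensor E' F') :=
  LinearMap.mk₂ ℂ map (by exact map_add_left) (by exact map_smul_left)
    (by exact map_add_right) (by exact map_smul_right)

variable (E E' F F') in
/-- The tensor product `A ⊗ B` of operators as a continuous bilinear function of `(A, B)`. -/
noncomputable def mapL : (E →L[ℂ] E') →L[ℂ] (F →L[ℂ] F') →L[ℂ]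
    (HilbertTensor E F →L[ℂ] HilbertTensor E' F') :=
  LinearMap.mkContinuous₂ (σ₁₃ := .id ℂ) (σ₂₃ := .id ℂ) (E := E →L[ℂ] E') (F := F →L[ℂ] F')
    (G := HilbertTensor E F →L[ℂ] HilbertTensor E' F') (mapₗ E E' F F') 1 fun A B => by
      rw [one_mul]
      exact norm_map_le A B

theorem mapL_apply (A : E →L[ℂ] E') (B : F →L[ℂ] F') : mapL E E' F F' A B = map A B := rfl

variable (E F G) in
/-- The unitary operator interchanging the last two factors of `(E ⊗ F) ⊗ G`. -/
noncomputable def rightComm :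
    HilbertTensor (HilbertTensor E F) G ≃ₗᵢ[ℂ] HilbertTensor (HilbertTensor E G) F :=
  isometryEquivOfInnerEq (a := fun p : (E × F) × G => mk (mk p.1.1 p.1.2) p.2)
    (b := fun p => mk (mk p.1.1 p.2) p.1.2) dense_span_range_mk_mk dense_span_range_mk_mk_swap
    fun p q => by simp only [inner_mk]; ring

theorem rightComm_mk (x : E) (y : F) (z : G) :
    rightComm E F G (mk (mk x y) z) = mk (mk x z) y :=
  isometryEquivOfInnerEq_apply _ _ _ ((x, y), z)

variable (E F G) in
/-- The unitary operator identifying `(E ⊗ F) ⊗ G` with `E ⊗ (F ⊗ G)`. -/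
noncomputable def assoc :
    HilbertTensor (HilbertTensor E F) G ≃ₗᵢ[ℂ] HilbertTensor E (HilbertTensor F G) :=
  isometryEquivOfInnerEq (a := fun p : (E × F) × G => mk (mk p.1.1 p.1.2) p.2)
    (b := fun p => mk p.1.1 (mk p.1.2 p.2)) dense_span_range_mk_mk dense_span_range_mk_mk_right
    fun p q => by simp only [inner_mk, mul_assoc]

theorem assoc_mk (x : E) (y : F) (z : G) : assoc E F G (mk (mk x y) z) = mk x (mk y z) :=
  isometryEquivOfInnerEq_apply _ _ _ ((x, y), z)

theorem assoc_symm_mk (x : E) (y : F) (z : G) :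
    (assoc E F G).symm (mk x (mk y z)) = mk (mk x y) z := by
  rw [← assoc_mk, LinearIsometryEquiv.symm_apply_apply]

end HilbertTensor

section Compression

variable {𝕜 E E' F F' : Type*} [NontriviallyNormedField 𝕜]
  [SeminormedAddCommGroup E] [NormedSpace 𝕜 E] [SeminormedAddCommGroup E'] [NormedSpace 𝕜 E']
  [SeminormedAddCommGroup F] [NormedSpace 𝕜 F] [SeminormedAddCommGroup F'] [NormedSpace 𝕜 F']

/-- The operator `X ↦ B X A` on operators. -/
noncomputable def compressionL (A : E' →L[𝕜] E) (B : F →L[𝕜] F') :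
    (E →L[𝕜] F) →L[𝕜] (E' →L[𝕜] F') :=
  (B.postcomp E').comp (A.precomp F)

theorem hasSum_compression {ι : Type*} {x : ι → E →L[𝕜] F} {X : E →L[𝕜] F} (h : HasSum x X)
    (A : E' →L[𝕜] E) (B : F →L[𝕜] F') : HasSum (fun i => B ∘L x i ∘L A) (B ∘L X ∘L A) :=
  (compressionL A B).hasSum h

theorem norm_compression_le {A : E' →L[𝕜] E} {B : F →L[𝕜] F'} (hA : ‖A‖ ≤ 1)
    (hB : ‖B‖ ≤ 1) (X : E →L[𝕜] F) : ‖B ∘L X ∘L A‖ ≤ ‖X‖ :=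
  calc ‖B ∘L X ∘L A‖ ≤ ‖B‖ * (‖X‖ * ‖A‖) :=
        (B.opNorm_comp_le _).trans (by gcongr; exact X.opNorm_comp_le A)
    _ ≤ ‖X‖ := (mul_le_of_le_one_left (by positivity) hB).trans
        (mul_le_of_le_one_right (norm_nonneg X) hA)

end Compression

namespace HilbertTensor

section Amplification

variable {E E' F F' G G' : Type*}
  [NormedAddCommGroup E] [InnerProductSpace ℂ E]
  [NormedAddCommGroup E'] [InnerProductSpace ℂ E']
  [NormedAddCommGroup F] [InnerProductSpace ℂ F]
  [NormedAddCommGroup F'] [InnerProductSpace ℂ F']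
  [NormedAddCommGroup G] [InnerProductSpace ℂ G]
  [NormedAddCommGroup G'] [InnerProductSpace ℂ G']

variable (E E') in
/-- The operator `A ↦ A ⊗ B` on operators. -/
noncomputable def mapLeftL (B : F →L[ℂ] F') :
    (E →L[ℂ] E') →L[ℂ] (HilbertTensor E F →L[ℂ] HilbertTensor E' F') :=
  ContinuousLinearMap.flip (σ₁₃ := .id ℂ) (σ₂₃ := .id ℂ) (E := E →L[ℂ] E') (F := F →L[ℂ] F')
    (G := HilbertTensor E F →L[ℂ] HilbertTensor E' F') (mapL E E' F F') B

theorem map_sum_left {ι : Type*} (s : Finset ι) (A : ι → E →L[ℂ] E') (B : F →L[ℂ] F') :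
    map (∑ i ∈ s, A i) B = ∑ i ∈ s, map (A i) B :=
  map_sum (mapLeftL E E' B) A s

theorem hasSum_map_left {ι : Type*} {x : ι → E →L[ℂ] E'} {X : E →L[ℂ] E'} (h : HasSum x X)
    (B : F →L[ℂ] F') : HasSum (fun i => map (x i) B) (map X B) :=
  (mapLeftL E E' B).hasSum h

theorem hasSum_map_right {ι : Type*} {y : ι → F →L[ℂ] F'} {Y : F →L[ℂ] F'} (h : HasSum y Y)
    (A : E →L[ℂ] E') : HasSum (fun i => map A (y i)) (map A Y) :=
  (mapL E E' F F' A).hasSum h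

variable (F) in
/-- For an operator `X` from `E ⊗ G` to `E' ⊗ G'`, the operator from `(E ⊗ F) ⊗ G` to
`(E' ⊗ F) ⊗ G'` that acts as `X` on the outer factors and as the identity on `F`. -/
noncomputable def amplifyLeft (X : HilbertTensor E G →L[ℂ] HilbertTensor E' G') :
    HilbertTensor (HilbertTensor E F) G →L[ℂ] HilbertTensor (HilbertTensor E' F) G' :=
  (rightComm E' G' F).toLinearIsometry.toContinuousLinearMap ∘L
    map X (ContinuousLinearMap.id ℂ F) ∘L
      (rightComm E F G).toLinearIsometry.toContinuousLinearMap

variable (E) in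
/-- For an operator `Y` from `F ⊗ G` to `F' ⊗ G'`, the operator `1 ⊗ Y` from `(E ⊗ F) ⊗ G` to
`(E ⊗ F') ⊗ G'`. -/
noncomputable def amplifyRight (Y : HilbertTensor F G →L[ℂ] HilbertTensor F' G') :
    HilbertTensor (HilbertTensor E F) G →L[ℂ] HilbertTensor (HilbertTensor E F') G' :=
  (assoc E F' G').symm.toLinearIsometry.toContinuousLinearMap ∘L
    map (ContinuousLinearMap.id ℂ E) Y ∘L
      (assoc E F G).toLinearIsometry.toContinuousLinearMap

theorem amplifyLeft_apply (X : HilbertTensor E G →L[ℂ] HilbertTensor E' G')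
    (t : HilbertTensor (HilbertTensor E F) G) :
    amplifyLeft F X t =
      rightComm E' G' F (map X (ContinuousLinearMap.id ℂ F) (rightComm E F G t)) := rfl

theorem amplifyRight_apply (Y : HilbertTensor F G →L[ℂ] HilbertTensor F' G')
    (t : HilbertTensor (HilbertTensor E F) G) :
    amplifyRight E Y t =
      (assoc E F' G').symm (map (ContinuousLinearMap.id ℂ E) Y (assoc E F G t)) := rfl

theorem hasSum_amplifyLeft {ι : Type*} {x : ι → HilbertTensor E G →L[ℂ] HilbertTensor E' G'}
    {X : HilbertTensor E G →L[ℂ] HilbertTensor E' G'} (h : HasSum x X) :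
    HasSum (fun i => amplifyLeft F (x i)) (amplifyLeft F X) :=
  hasSum_compression (E := HilbertTensor (HilbertTensor E G) F)
    (F := HilbertTensor (HilbertTensor E' G') F)
    (hasSum_map_left h (ContinuousLinearMap.id ℂ F)) _ _

theorem hasSum_amplifyRight {ι : Type*} {y : ι → HilbertTensor F G →L[ℂ] HilbertTensor F' G'}
    {Y : HilbertTensor F G →L[ℂ] HilbertTensor F' G'} (h : HasSum y Y) :
    HasSum (fun i => amplifyRight E (y i)) (amplifyRight E Y) :=
  hasSum_compression (E := HilbertTensor E (HilbertTensor F G))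
    (F := HilbertTensor E (HilbertTensor F' G'))
    (hasSum_map_right h (ContinuousLinearMap.id ℂ E)) _ _

theorem amplifyLeft_comp_amplifyRight_map (A : E →L[ℂ] E') (B : F →L[ℂ] F')
    (C D : G →L[ℂ] G) :
    amplifyLeft F' (map A C) ∘L amplifyRight E (map B D) = map (map A B) (C * D) :=
  ext_mk_mk fun x y z => by
    simp only [ContinuousLinearMap.comp_apply, amplifyLeft_apply, amplifyRight_apply, assoc_mk,
      assoc_symm_mk, rightComm_mk, map_mk, ContinuousLinearMap.id_apply, mul_apply_eq_comp]

theorem norm_map_id_right_le (A : E →L[ℂ] E') : ‖map A (ContinuousLinearMap.id ℂ F)‖ ≤ ‖A‖ :=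
  (norm_map_le A _).trans
    (mul_le_of_le_one_right (norm_nonneg A) ContinuousLinearMap.norm_id_le)

theorem norm_map_id_left_le (B : F →L[ℂ] F') : ‖map (ContinuousLinearMap.id ℂ E) B‖ ≤ ‖B‖ :=
  (norm_map_le _ B).trans
    (mul_le_of_le_one_left (norm_nonneg B) ContinuousLinearMap.norm_id_le)

theorem norm_amplifyLeft_le (X : HilbertTensor E G →L[ℂ] HilbertTensor E' G') :
    ‖amplifyLeft F X‖ ≤ ‖X‖ :=
  (norm_compression_le (rightComm E F G).toLinearIsometry.norm_toContinuousLinearMap_le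
    (rightComm E' G' F).toLinearIsometry.norm_toContinuousLinearMap_le _).trans
      (norm_map_id_right_le X)

theorem norm_amplifyRight_le (Y : HilbertTensor F G →L[ℂ] HilbertTensor F' G') :
    ‖amplifyRight E Y‖ ≤ ‖Y‖ :=
  (norm_compression_le (assoc E F G).toLinearIsometry.norm_toContinuousLinearMap_le
    (assoc E F' G').symm.toLinearIsometry.norm_toContinuousLinearMap_le _).trans
      (norm_map_id_left_le Y)

theorem norm_amplifyLeft_comp_amplifyRight_le (X : HilbertTensor E G →L[ℂ] HilbertTensor E' G')
    (Y : HilbertTensor F G →L[ℂ] HilbertTensor F' G) :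
    ‖amplifyLeft F' X ∘L amplifyRight E Y‖ ≤ ‖X‖ * ‖Y‖ :=
  (ContinuousLinearMap.opNorm_comp_le _ _).trans <|
    mul_le_mul (norm_amplifyLeft_le X) (norm_amplifyRight_le Y)
      (ContinuousLinearMap.opNorm_nonneg _) (ContinuousLinearMap.opNorm_nonneg X)

end Amplification

end HilbertTensor

noncomputable instance instHasAntidiagonalPiFin {d : ℕ} : Finset.HasAntidiagonal (Fin d → ℕ) :=
  Finset.HasAntidiagonal.antidiagonalOfLocallyFinite

/-- The coefficients of the product, formed by means of the bilinear map `L`, of the power series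
with coefficients `a` and `b`. -/
noncomputable def cauchyProduct {d : ℕ} {E F G : Type*}
    [NormedAddCommGroup E] [NormedSpace ℂ E] [NormedAddCommGroup F] [NormedSpace ℂ F]
    [NormedAddCommGroup G] [NormedSpace ℂ G] (L : E →L[ℂ] F →L[ℂ] G)
    (a : (Fin d → ℕ) → E) (b : (Fin d → ℕ) → F) (t : Fin d → ℕ) : G :=
  ∑ p ∈ Finset.HasAntidiagonal.antidiagonal t, L (a p.1) (b p.2)

section Expansion

variable {d : ℕ} {E F G : Type*}
  [NormedAddCommGroup E] [NormedSpace ℂ E] [NormedAddCommGroup F] [NormedSpace ℂ F]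
  [NormedAddCommGroup G] [NormedSpace ℂ G]

theorem hasPolydiskExpansion_const (x : E) :
    HasPolydiskExpansion (d := d) (Pi.single 0 x) fun _ => x := fun z _ => by
  have hasSum := hasSum_single (f := fun r : Fin d → ℕ =>
    (∏ i, z i ^ r i) • (Pi.single 0 x : (Fin d → ℕ) → E) r) 0
      fun r hr => by rw [Pi.single_eq_of_ne hr, smul_zero]
  simpa using hasSum

theorem HasPolydiskExpansion.continuousLinearMap_apply {c : (Fin d → ℕ) → E}
    {f : (Fin d → ℂ) → E} (h : HasPolydiskExpansion c f) (L : E →L[ℂ] F) :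
    HasPolydiskExpansion (fun r => L (c r)) fun z => L (f z) := fun z hz => by
  simpa only [map_smul] using L.hasSum (h z hz)

theorem HasPolydiskExpansion.bilinear [CompleteSpace G] {a : (Fin d → ℕ) → E}
    {b : (Fin d → ℕ) → F} {f : (Fin d → ℂ) → E} {g : (Fin d → ℂ) → F}
    (hf : HasPolydiskExpansion a f) (hg : HasPolydiskExpansion b g) (L : E →L[ℂ] F →L[ℂ] G) :
    HasPolydiskExpansion (cauchyProduct L a b) fun z => L (f z) (g z) := fun z hz => by
  refine (hasSum_bilinear_antidiagonal L (hf z hz) (hg z hz) (hf.summable_norm_smul hz)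
    (hg.summable_norm_smul hz)).congr_fun fun t => ?_
  rw [cauchyProduct, Finset.smul_sum]
  refine Finset.sum_congr rfl fun p hp => ?_
  rw [map_smul, map_smul, smul_apply, smul_smul, ← Finset.HasAntidiagonal.mem_antidiagonal.1 hp,
    ← Finset.prod_mul_distrib]
  simp only [Pi.add_apply, pow_add, mul_comm]

end Expansion

section FunctionalCalculus

open HilbertTensor

variable {d : ℕ} {U U' U₁ U₂ V V' V₁ V₂ H : Type*}
  [NormedAddCommGroup U] [InnerProductSpace ℂ U] [NormedAddCommGroup U'] [InnerProductSpace ℂ U']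
  [NormedAddCommGroup U₁] [InnerProductSpace ℂ U₁] [NormedAddCommGroup U₂] [InnerProductSpace ℂ U₂]
  [NormedAddCommGroup V] [InnerProductSpace ℂ V] [NormedAddCommGroup V'] [InnerProductSpace ℂ V']
  [NormedAddCommGroup V₁] [InnerProductSpace ℂ V₁] [NormedAddCommGroup V₂] [InnerProductSpace ℂ V₂]
  [NormedAddCommGroup H] [InnerProductSpace ℂ H]

/-- `X` is the value `∑ r, c_r ⊗ T^r` at the operator tuple `T` of the power series with
coefficients `c`. -/
def HasOperatorValue (c : (Fin d → ℕ) → U →L[ℂ] V) (T : Fin d → H →L[ℂ] H)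
    (X : HilbertTensor U H →L[ℂ] HilbertTensor V H) : Prop :=
  HasSum (fun r => map (c r) (opMonomial T r)) X

theorem HasPolydiskExpansion.summable_norm_map_opMonomial {c : (Fin d → ℕ) → U →L[ℂ] V}
    {f : (Fin d → ℂ) → U →L[ℂ] V} (h : HasPolydiskExpansion c f) {T : Fin d → H →L[ℂ] H}
    (hT : ∀ i, ‖T i‖ < 1) : Summable fun r => ‖map (c r) (opMonomial T r)‖ :=
  (h.summable_norm_mul_prod (fun i => norm_nonneg (T i)) hT).of_nonneg_of_le
    (fun _ => ContinuousLinearMap.opNorm_nonneg _) fun r =>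
      (norm_map_le _ _).trans (mul_le_mul_of_nonneg_left (norm_opMonomial_le T r) (norm_nonneg _))

theorem hasOperatorValue_single_zero (A : U →L[ℂ] V) (T : Fin d → H →L[ℂ] H) :
    HasOperatorValue (Pi.single 0 A) T (map A (ContinuousLinearMap.id ℂ H)) := by
  have hasSum := hasSum_single (f := fun r : Fin d → ℕ =>
    map ((Pi.single 0 A : (Fin d → ℕ) → U →L[ℂ] V) r) (opMonomial T r)) 0
      fun r hr => by rw [Pi.single_eq_of_ne hr, ← mapL_apply, map_zero]; rfl
  rwa [Pi.single_eq_same, opMonomial_zero] at hasSum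

theorem HasOperatorValue.compress {c : (Fin d → ℕ) → U →L[ℂ] V} {T : Fin d → H →L[ℂ] H}
    {X : HilbertTensor U H →L[ℂ] HilbertTensor V H} (h : HasOperatorValue c T X)
    (A : U' →L[ℂ] U) (B : V →L[ℂ] V') :
    HasOperatorValue (fun r => B ∘L c r ∘L A) T
      (map B (ContinuousLinearMap.id ℂ H) ∘L X ∘L map A (ContinuousLinearMap.id ℂ H)) := by
  refine (hasSum_compression h _ _).congr_fun fun r => ?_
  rw [map_comp_map, map_comp_map]
  rfl

theorem HasPolydiskExpansion.tensor {a : (Fin d → ℕ) → U₁ →L[ℂ] V₁}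
    {b : (Fin d → ℕ) → U₂ →L[ℂ] V₂} {f : (Fin d → ℂ) → U₁ →L[ℂ] V₁}
    {g : (Fin d → ℂ) → U₂ →L[ℂ] V₂} (hf : HasPolydiskExpansion a f)
    (hg : HasPolydiskExpansion b g) :
    HasPolydiskExpansion (cauchyProduct (mapL U₁ V₁ U₂ V₂) a b) fun z => map (f z) (g z) :=
  (HasPolydiskExpansion.bilinear (E := U₁ →L[ℂ] V₁) (F := U₂ →L[ℂ] V₂)
    (G := HilbertTensor U₁ U₂ →L[ℂ] HilbertTensor V₁ V₂) hf hg (mapL U₁ V₁ U₂ V₂) :)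

theorem map_cauchyProduct_opMonomial (a : (Fin d → ℕ) → U₁ →L[ℂ] V₁)
    (b : (Fin d → ℕ) → U₂ →L[ℂ] V₂) {T : Fin d → H →L[ℂ] H} (hT : ∀ i j, Commute (T i) (T j))
    (t : Fin d → ℕ) :
    map (cauchyProduct (mapL U₁ V₁ U₂ V₂) a b t) (opMonomial T t) =
      ∑ p ∈ Finset.HasAntidiagonal.antidiagonal t,
        amplifyLeft V₂ (map (a p.1) (opMonomial T p.1)) ∘L
          amplifyRight U₁ (map (b p.2) (opMonomial T p.2)) := by
  rw [cauchyProduct, map_sum_left]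
  refine Finset.sum_congr rfl fun p hp => ?_
  rw [mapL_apply, amplifyLeft_comp_amplifyRight_map, ← opMonomial_add hT,
    Finset.HasAntidiagonal.mem_antidiagonal.1 hp]

theorem HasOperatorValue.tensor {a : (Fin d → ℕ) → U₁ →L[ℂ] V₁}
    {b : (Fin d → ℕ) → U₂ →L[ℂ] V₂} {T : Fin d → H →L[ℂ] H}
    {X : HilbertTensor U₁ H →L[ℂ] HilbertTensor V₁ H}
    {Y : HilbertTensor U₂ H →L[ℂ] HilbertTensor V₂ H}
    (hX : HasOperatorValue a T X) (hY : HasOperatorValue b T Y)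
    (ha : Summable fun r => ‖map (a r) (opMonomial T r)‖)
    (hb : Summable fun r => ‖map (b r) (opMonomial T r)‖) (hT : ∀ i j, Commute (T i) (T j)) :
    HasOperatorValue (cauchyProduct (mapL U₁ V₁ U₂ V₂) a b) T
      (amplifyLeft V₂ X ∘L amplifyRight U₁ Y) :=
  (hasSum_comp_antidiagonal (E := HilbertTensor (HilbertTensor U₁ U₂) H)
    (F := HilbertTensor (HilbertTensor U₁ V₂) H) (G := HilbertTensor (HilbertTensor V₁ V₂) H)
    (hasSum_amplifyLeft hX) (hasSum_amplifyRight hY)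
    (ha.of_nonneg_of_le (fun _ => norm_nonneg _) fun _ => norm_amplifyLeft_le _)
    (hb.of_nonneg_of_le (fun _ => norm_nonneg _) fun _ => norm_amplifyRight_le _)).congr_fun
    (map_cauchyProduct_opMonomial a b hT)

end FunctionalCalculus

section SchurAgler

open HilbertTensor

variable {d : ℕ} {U U' U₁ U₂ V V' V₁ V₂ : Type*}
  [NormedAddCommGroup U] [InnerProductSpace ℂ U] [NormedAddCommGroup U'] [InnerProductSpace ℂ U']
  [NormedAddCommGroup U₁] [InnerProductSpace ℂ U₁] [NormedAddCommGroup U₂] [InnerProductSpace ℂ U₂]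
  [NormedAddCommGroup V] [InnerProductSpace ℂ V] [NormedAddCommGroup V'] [InnerProductSpace ℂ V']
  [NormedAddCommGroup V₁] [InnerProductSpace ℂ V₁] [NormedAddCommGroup V₂] [InnerProductSpace ℂ V₂]

theorem isSchurAgler_const {A : U →L[ℂ] V} (hA : ‖A‖ ≤ 1) :
    IsSchurAgler.{_, _, w} fun _ : Fin d → ℂ => A :=
  ⟨fun _ _ => analyticAt_const, Pi.single 0 A, hasPolydiskExpansion_const A,
    fun H _ _ _ T _ _ => ⟨map A (ContinuousLinearMap.id ℂ H), hasOperatorValue_single_zero A T,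
      (norm_map_id_right_le A).trans hA⟩⟩

theorem IsSchurAgler.compress {f : (Fin d → ℂ) → U →L[ℂ] V} (hf : IsSchurAgler.{_, _, w} f)
    {A : U' →L[ℂ] U} {B : V →L[ℂ] V'} (hA : ‖A‖ ≤ 1) (hB : ‖B‖ ≤ 1) :
    IsSchurAgler.{_, _, w} fun z => B ∘L f z ∘L A := by
  obtain ⟨analytic, c, expansion, value⟩ := hf
  refine ⟨fun z hz => ((compressionL A B).analyticAt (f z)).fun_comp (analytic z hz),
    fun r => B ∘L c r ∘L A, expansion.continuousLinearMap_apply (compressionL A B),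
    fun H _ _ _ T hT hT_norm => ?_⟩
  obtain ⟨X, hX, hX_norm⟩ := value H T hT hT_norm
  exact ⟨_, HasOperatorValue.compress hX A B,
    (norm_compression_le (E := HilbertTensor U H) (F := HilbertTensor V H)
      ((norm_map_id_right_le A).trans hA) ((norm_map_id_right_le B).trans hB) X).trans hX_norm⟩

theorem HilbertTensor.analyticOnNhd_map {Z : Type*} [NormedAddCommGroup Z] [NormedSpace ℂ Z]
    {f : Z → U₁ →L[ℂ] V₁} {g : Z → U₂ →L[ℂ] V₂} {s : Set Z} (hf : AnalyticOnNhd ℂ f s)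
    (hg : AnalyticOnNhd ℂ g s) : AnalyticOnNhd ℂ (fun z => map (f z) (g z)) s := fun z hz =>
  (ContinuousLinearMap.analyticAt_bilinear (𝕜 := ℂ) (E := U₁ →L[ℂ] V₁) (F := U₂ →L[ℂ] V₂)
    (G := HilbertTensor U₁ U₂ →L[ℂ] HilbertTensor V₁ V₂) (mapL U₁ V₁ U₂ V₂)
    (f z, g z)).fun_comp (f := fun z => (f z, g z)) ((hf z hz).prod (hg z hz))

theorem IsSchurAgler.tensor {f : (Fin d → ℂ) → U₁ →L[ℂ] V₁} {g : (Fin d → ℂ) → U₂ →L[ℂ] V₂}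
    (hf : IsSchurAgler.{_, _, w} f) (hg : IsSchurAgler.{_, _, w} g) :
    IsSchurAgler.{_, _, w} fun z => map (f z) (g z) := by
  obtain ⟨f_analytic, a, f_expansion, f_value⟩ := hf
  obtain ⟨g_analytic, b, g_expansion, g_value⟩ := hg
  refine ⟨analyticOnNhd_map f_analytic g_analytic, cauchyProduct (mapL U₁ V₁ U₂ V₂) a b,
    f_expansion.tensor g_expansion, fun H _ _ _ T hT hT_norm => ?_⟩
  obtain ⟨X, hX, hX_norm⟩ := f_value H T hT hT_norm
  obtain ⟨Y, hY, hY_norm⟩ := g_value H T hT hT_norm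
  refine ⟨amplifyLeft V₂ X ∘L amplifyRight U₁ Y,
    HasOperatorValue.tensor hX hY (f_expansion.summable_norm_map_opMonomial hT_norm)
      (g_expansion.summable_norm_map_opMonomial hT_norm) hT, ?_⟩
  exact (norm_amplifyLeft_comp_amplifyRight_le X Y).trans
    (mul_le_one₀ hX_norm (ContinuousLinearMap.opNorm_nonneg Y) hY_norm)

end SchurAgler

section TensorPowers

variable {d : ℕ} {U : Type u} {V : Type v}
  [NormedAddCommGroup U] [InnerProductSpace ℂ U] [NormedAddCommGroup V] [InnerProductSpace ℂ V]

theorem TensorPow.norm_map_zero_le (A : Fin 0 → U →L[ℂ] V) : ‖TensorPow.map 0 A‖ ≤ 1 :=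
  (LinearIsometryEquiv.piLpCongrLeft 2 ℂ ℂ
    (Equiv.punitEquivPUnit : PUnit.{u + 1} ≃ PUnit.{v + 1})).toLinearIsometry
      |>.norm_toContinuousLinearMap_le

theorem isSchurAgler_tensorFun : ∀ {k : ℕ} {S : Fin k → (Fin d → ℂ) → U →L[ℂ] V},
    (∀ j, IsSchurAgler.{u, v, w} (S j)) → IsSchurAgler.{u, v, w} (tensorFun S)
  | 0, _, _ => isSchurAgler_const (TensorPow.norm_map_zero_le Fin.elim0)
  | _ + 1, _, hS => (isSchurAgler_tensorFun fun j => hS j.castSucc).tensor (hS (Fin.last _))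

theorem isSchurAgler_wedgeFun {k : ℕ} {S : Fin k → (Fin d → ℂ) → U →L[ℂ] V}
    (hS : ∀ j, IsSchurAgler.{u, v, w} (S j)) : IsSchurAgler.{u, v, w} (wedgeFun S) :=
  (isSchurAgler_tensorFun hS).compress (Submodule.norm_subtypeL_le _)
    (Submodule.orthogonalProjectionOnto_norm_le _)

end TensorPowers

namespace TensorPow

variable {U : Type u} {V : Type v}
  [NormedAddCommGroup U] [InnerProductSpace ℂ U] [NormedAddCommGroup V] [InnerProductSpace ℂ V]

theorem inner_tprod : ∀ (k : ℕ) (x y : Fin k → U),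
    ⟪tprod k x, tprod k y⟫_ℂ = ∏ i, ⟪x i, y i⟫_ℂ
  | 0, x, y => by
    have inner_single : ⟪(EuclideanSpace.single PUnit.unit 1 : EuclideanSpace ℂ PUnit.{u + 1}),
        EuclideanSpace.single PUnit.unit 1⟫_ℂ = 1 := by simp
    rw [Fin.prod_univ_zero]
    exact inner_single
  | k + 1, x, y => by
    rw [Fin.prod_univ_castSucc, ← inner_tprod k]
    exact HilbertTensor.inner_mk _ _ _ _

theorem map_tprod : ∀ (k : ℕ) (A : Fin k → U →L[ℂ] V) (x : Fin k → U),
    map k A (tprod k x) = tprod k fun i => A i (x i)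
  | 0, _, _ => by
    have congr_single : LinearIsometryEquiv.piLpCongrLeft 2 ℂ ℂ
        (Equiv.punitEquivPUnit : PUnit.{u + 1} ≃ PUnit.{v + 1})
          (EuclideanSpace.single PUnit.unit 1) = EuclideanSpace.single PUnit.unit 1 := by
      ext; simp
    exact congr_single
  | k + 1, A, x => by
    have map_mk := HilbertTensor.map_mk (map k fun i => A i.castSucc) (A (Fin.last k))
      (tprod k fun i => x i.castSucc) (x (Fin.last k))
    rw [map_tprod k] at map_mk
    exact map_mk

theorem map_wedge (k : ℕ) (A : U →L[ℂ] V) (x : Fin k → U) :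
    map k (fun _ => A) (wedge k x) = wedge k fun i => A (x i) := by
  simp only [wedge, map_sum, map_smul, map_tprod]

theorem inner_tprod_wedge (k : ℕ) (x y : Fin k → U) :
    ⟪tprod k x, wedge k y⟫_ℂ = (Matrix.of fun i j => ⟪x i, y j⟫_ℂ).det := by
  rw [← Matrix.det_transpose, Matrix.det_apply']
  simp only [wedge, inner_sum, inner_smul_right, inner_tprod, Matrix.transpose_apply,
    Matrix.of_apply]

theorem inner_wedge (k : ℕ) (x y : Fin k → U) :
    ⟪wedge k x, wedge k y⟫_ℂ = k.factorial * (Matrix.of fun i j => ⟪x i, y j⟫_ℂ).det := by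
  have inner_permuted : ∀ σ : Equiv.Perm (Fin k),
      ((Equiv.Perm.sign σ : ℤ) : ℂ) * ⟪tprod k fun i => x (σ i), wedge k y⟫_ℂ =
        (Matrix.of fun i j => ⟪x i, y j⟫_ℂ).det := fun σ => by
    rw [inner_tprod_wedge]
    refine (congrArg _ (Matrix.det_permute σ (Matrix.of fun i j => ⟪x i, y j⟫_ℂ))).trans ?_
    rw [← mul_assoc, ← Int.cast_mul, Int.units_coe_mul_self, Int.cast_one, one_mul]
  rw [wedge, sum_inner]
  simp only [inner_smul_left, map_intCast, inner_permuted, Finset.sum_const, Finset.card_univ,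
    Fintype.card_perm, Fintype.card_fin, nsmul_eq_mul]

/-- The elementary antisymmetric tensor `v_1 ∧ ⋯ ∧ v_k` divided by `√k!`, so that the inner
products of such tensors are the Gram determinants of the vectors. -/
noncomputable def normalizedWedge (k : ℕ) (x : Fin k → U) : TensorPow k U :=
  ((√k.factorial : ℝ) : ℂ)⁻¹ • wedge k x

theorem inner_normalizedWedge (k : ℕ) (x y : Fin k → U) :
    ⟪normalizedWedge k x, normalizedWedge k y⟫_ℂ = (Matrix.of fun i j => ⟪x i, y j⟫_ℂ).det := by
  have sqrt_mul_sqrt : ((√k.factorial : ℝ) : ℂ) * ((√k.factorial : ℝ) : ℂ) = k.factorial := by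
    rw [← Complex.ofReal_mul, Real.mul_self_sqrt (Nat.cast_nonneg _), Complex.ofReal_natCast]
  rw [normalizedWedge, normalizedWedge, inner_smul_left, inner_smul_right, inner_wedge, map_inv₀,
    Complex.conj_ofReal, ← mul_assoc, ← mul_inv, sqrt_mul_sqrt,
    inv_mul_cancel_left₀ (Nat.cast_ne_zero.2 k.factorial_ne_zero)]

theorem map_normalizedWedge (k : ℕ) (A : U →L[ℂ] V) (x : Fin k → U) :
    map k (fun _ => A) (normalizedWedge k x) = normalizedWedge k fun i => A (x i) := by
  rw [normalizedWedge, map_smul, map_wedge, normalizedWedge]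

end TensorPow

section MatrixElements

variable {d : ℕ} {U V ι : Type*} [Fintype ι]
  [NormedAddCommGroup U] [InnerProductSpace ℂ U] [NormedAddCommGroup V] [InnerProductSpace ℂ V]

theorem exists_linearIsometry_single_eq [DecidableEq ι] {v : ι → V} (hv : Orthonormal ℂ v) :
    ∃ L : EuclideanSpace ℂ ι →ₗᵢ[ℂ] V, ∀ i, L (EuclideanSpace.single i 1) = v i := by
  let basis := EuclideanSpace.basisFun ι ℂ
  have constr_comp : basis.toBasis.constr ℂ v ∘ basis.toBasis = v :=
    funext (basis.toBasis.constr_basis ℂ v)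
  refine ⟨(basis.toBasis.constr ℂ v).isometryOfOrthonormal (v := basis.toBasis)
    (by rw [basis.coe_toBasis]; exact basis.orthonormal) (by rwa [constr_comp]), fun i => ?_⟩
  simp [basis]

theorem inner_single_toEuclideanCLM_single [DecidableEq ι] (M : Matrix ι ι ℂ) (i j : ι) :
    ⟪(EuclideanSpace.single i 1 : EuclideanSpace ℂ ι),
      Matrix.toEuclideanCLM (n := ι) (𝕜 := ℂ) M (EuclideanSpace.single j 1)⟫_ℂ = M i j := by
  simp [EuclideanSpace.inner_single_left]

theorem toEuclideanCLM_eq_of_inner_single [DecidableEq ι] {M : Matrix ι ι ℂ}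
    {A : EuclideanSpace ℂ ι →L[ℂ] EuclideanSpace ℂ ι}
    (h : ∀ i j, ⟪(EuclideanSpace.single i 1 : EuclideanSpace ℂ ι),
      A (EuclideanSpace.single j 1)⟫_ℂ = M i j) :
    Matrix.toEuclideanCLM (n := ι) (𝕜 := ℂ) M = A := by
  let basis := EuclideanSpace.basisFun ι ℂ
  refine ContinuousLinearMap.coe_injective (basis.toBasis.ext fun j => ?_)
  refine InnerProductSpace.ext_inner_left_basis basis.toBasis fun i => ?_
  simpa [basis] using (inner_single_toEuclideanCLM_single M i j).trans (h i j).symm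

theorem IsSchurAgler.matrix_inner [DecidableEq ι] [CompleteSpace V]
    {f : (Fin d → ℂ) → U →L[ℂ] V} (hf : IsSchurAgler.{_, _, w} f) {u : ι → U} {v : ι → V}
    (hu : Orthonormal ℂ u) (hv : Orthonormal ℂ v) :
    IsMatrixSchurAgler.{w} fun z => Matrix.of fun i j => ⟪v i, f z (u j)⟫_ℂ := by
  obtain ⟨A, hA⟩ := exists_linearIsometry_single_eq hu
  obtain ⟨B, hB⟩ := exists_linearIsometry_single_eq hv
  have compressed := hf.compress (A := A.toContinuousLinearMap)
    (B := B.toContinuousLinearMap.adjoint) A.norm_toContinuousLinearMap_le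
    (by rw [LinearIsometryEquiv.norm_map]; exact B.norm_toContinuousLinearMap_le)
  refine (congrArg IsSchurAgler (funext fun z => ?_)).mpr compressed
  refine toEuclideanCLM_eq_of_inner_single
    (M := Matrix.of fun i j => ⟪v i, f z (u j)⟫_ℂ) fun i j => ?_
  rw [ContinuousLinearMap.comp_apply, ContinuousLinearMap.comp_apply,
    ContinuousLinearMap.adjoint_inner_right, Matrix.of_apply, ← hA, ← hB]
  rfl

theorem IsSchurAgler.scalar_inner {f : (Fin d → ℂ) → U →L[ℂ] V} (hf : IsSchurAgler.{_, _, w} f)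
    {u : U} {v : V} (hu : ‖u‖ ≤ 1) (hv : ‖v‖ ≤ 1) :
    IsScalarSchurAgler.{w} fun z => ⟪v, f z u⟫_ℂ := by
  have compressed := hf.compress (A := ContinuousLinearMap.toSpanSingleton ℂ u) (B := innerSL ℂ v)
    (by rwa [ContinuousLinearMap.norm_toSpanSingleton]) (by rwa [innerSL_apply_norm])
  refine (congrArg IsSchurAgler (funext fun z => ?_)).mpr compressed
  ext
  simp

end MatrixElements

section CompoundMatrix

variable {d n k : ℕ}

theorem compoundMatrix_one : compoundMatrix k (1 : Matrix (Fin n) (Fin n) ℂ) = 1 := by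
  ext I J
  rw [compoundMatrix, Matrix.of_apply]
  obtain rfl | h := eq_or_ne I J
  · rw [Matrix.submatrix_one _ (I.1.orderEmbOfFin I.2).injective, Matrix.det_one,
      Matrix.one_apply_eq]
  · obtain ⟨a, ha, ha'⟩ : ∃ a ∈ I.1, a ∉ J.1 := Finset.not_subset.1 fun hIJ =>
      h (Subtype.ext (Finset.eq_of_subset_of_card_le hIJ (by rw [I.2, J.2])))
    obtain ⟨i, rfl⟩ : a ∈ Set.range (I.1.orderEmbOfFin I.2) := by
      rwa [Finset.range_orderEmbOfFin]
    rw [Matrix.one_apply_ne h]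
    refine Matrix.det_eq_zero_of_row_eq_zero i fun j => Matrix.one_apply_ne fun hij => ha' ?_
    exact hij ▸ Finset.orderEmbOfFin_mem J.1 J.2 j

theorem compoundMatrix_univ (M : Matrix (Fin n) (Fin n) ℂ) :
    compoundMatrix n M ⟨Finset.univ, Finset.card_fin n⟩ ⟨Finset.univ, Finset.card_fin n⟩ =
      M.det := by
  have emb_eq_id : id = (Finset.univ : Finset (Fin n)).orderEmbOfFin (Finset.card_fin n) :=
    Finset.orderEmbOfFin_unique _ (fun _ => Finset.mem_univ _) strictMono_id
  rw [compoundMatrix, Matrix.of_apply, ← emb_eq_id, Matrix.submatrix_id_id]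

/-- The normalized antisymmetric tensor of the standard basis vectors with indices in `I`, listed
increasingly. -/
noncomputable def wedgeBasis (I : {s : Finset (Fin n) // s.card = k}) :
    TensorPow k (EuclideanSpace ℂ (Fin n)) :=
  TensorPow.normalizedWedge k fun i => EuclideanSpace.single (I.1.orderEmbOfFin I.2 i) 1

theorem inner_wedgeBasis_map_wedgeBasis (M : Matrix (Fin n) (Fin n) ℂ)
    (I J : {s : Finset (Fin n) // s.card = k}) :
    ⟪wedgeBasis I, TensorPow.map k (fun _ => Matrix.toEuclideanCLM (n := Fin n) (𝕜 := ℂ) M)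
      (wedgeBasis J)⟫_ℂ = compoundMatrix k M I J := by
  rw [wedgeBasis, wedgeBasis, TensorPow.map_normalizedWedge, TensorPow.inner_normalizedWedge]
  simp only [inner_single_toEuclideanCLM_single]
  rfl

theorem orthonormal_wedgeBasis :
    Orthonormal ℂ (wedgeBasis : {s : Finset (Fin n) // s.card = k} → _) := by
  refine orthonormal_iff_ite.2 fun I J => ?_
  rw [← Matrix.one_apply, ← compoundMatrix_one, ← inner_wedgeBasis_map_wedgeBasis, wedgeBasis,
    wedgeBasis, TensorPow.map_normalizedWedge, map_one]
  rfl

theorem isMatrixSchurAgler_compoundMatrix {S : (Fin d → ℂ) → Matrix (Fin n) (Fin n) ℂ}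
    (hS : IsMatrixSchurAgler.{w} S) (k : ℕ) :
    IsMatrixSchurAgler.{w} fun z => compoundMatrix k (S z) := by
  have matrix_elements := (isSchurAgler_tensorFun (k := k) fun _ => hS).matrix_inner
    orthonormal_wedgeBasis orthonormal_wedgeBasis
  refine (congrArg IsMatrixSchurAgler (funext fun z => ?_)).mpr matrix_elements
  ext I J
  exact (inner_wedgeBasis_map_wedgeBasis (S z) I J).symm

theorem isScalarSchurAgler_det {S : (Fin d → ℂ) → Matrix (Fin n) (Fin n) ℂ}
    (hS : IsMatrixSchurAgler.{w} S) : IsScalarSchurAgler.{w} fun z => (S z).det := by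
  let top : {s : Finset (Fin n) // s.card = n} := ⟨Finset.univ, Finset.card_fin n⟩
  have norm_le : ‖wedgeBasis top‖ ≤ 1 := (orthonormal_wedgeBasis.1 top).le
  have matrix_element := (isSchurAgler_tensorFun (k := n) fun _ => hS).scalar_inner norm_le norm_le
  refine (congrArg IsScalarSchurAgler (funext fun z => ?_)).mpr matrix_element
  rw [← compoundMatrix_univ]
  exact (inner_wedgeBasis_map_wedgeBasis (S z) top top).symm

end CompoundMatrix

theorem mainTheorem5_general (d : ℕ) :
    (∀ (U : Type u) (V : Type v)
        [NormedAddCommGroup U] [InnerProductSpace ℂ U]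
        [NormedAddCommGroup V] [InnerProductSpace ℂ V]
        (k : ℕ) (S : Fin k → (Fin d → ℂ) → U →L[ℂ] V),
        (∀ j, IsSchurAgler.{u, v, w} (S j)) →
          IsSchurAgler.{u, v, w} (tensorFun S) ∧ IsSchurAgler.{u, v, w} (wedgeFun S)) ∧
    (∀ (n : ℕ) (S : (Fin d → ℂ) → Matrix (Fin n) (Fin n) ℂ),
        IsMatrixSchurAgler.{w} S →
          (∀ k, IsMatrixSchurAgler.{w} fun z => compoundMatrix k (S z)) ∧
          IsScalarSchurAgler.{w} fun z => (S z).det) :=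
  ⟨fun _ _ _ _ _ _ _ _ hS => ⟨isSchurAgler_tensorFun hS, isSchurAgler_wedgeFun hS⟩,
    fun _ _ hS => ⟨isMatrixSchurAgler_compoundMatrix hS, isScalarSchurAgler_det hS⟩⟩

theorem mainTheorem5 (d : ℕ) :
    (∀ (U : Type u) (V : Type v)
        [NormedAddCommGroup U] [InnerProductSpace ℂ U] [CompleteSpace U]
        [NormedAddCommGroup V] [InnerProductSpace ℂ V] [CompleteSpace V]
        (k : ℕ) (S : Fin k → (Fin d → ℂ) → U →L[ℂ] V),
        (∀ j, IsSchurAgler.{u, v, w} (S j)) →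
          IsSchurAgler.{u, v, w} (tensorFun S) ∧ IsSchurAgler.{u, v, w} (wedgeFun S)) ∧
    (∀ (n : ℕ) (S : (Fin d → ℂ) → Matrix (Fin n) (Fin n) ℂ),
        IsMatrixSchurAgler.{w} S →
          (∀ k, 1 ≤ k → k ≤ n → IsMatrixSchurAgler.{w} fun z => compoundMatrix k (S z)) ∧
          IsScalarSchurAgler.{w} fun z => (S z).det) :=
  ⟨fun U V _ _ _ _ _ _ => (mainTheorem5_general.{u, v, w} d).1 U V, fun n S hS =>
    ((mainTheorem5_general.{u, v, w} d).2 n S hS).imp_left fun compound k _ _ => compound k⟩
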